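/- Let $l>0$, $\alpha,\theta\in\mathbb{R}$, $\beta\in\mathbb{R}\setminus\{0\}$, and let $V\in L^2[0,l]$ be real-valued. Let $D$ be the Dirichlet operator in $L^2[0,l]$, \[ Df=-f''+Vf,\qquad \operatorname{dom}D=\{f\in H^2[0,l]: f(0)=f(l)=0\}. \] Let $\mathcal H=\bigoplus_{(m,n)\in\mathbb{Z}^2}\big(L^2[0,l]\oplus L^2[0,l]\big)$, with elements $\phi=(\phi_{m,n,r},\phi_{m,n,u})_{(m,n)\in\mathbb{Z}^2}$, and let $\Lambda$ be the operator in $\mathcal H$ that acts on each component as $\phi_{m,n,r/u}\mapsto-\phi''_{m,n,r/u}+V\phi_{m,n,r/u}$, whose domain consists of all $\phi\in\mathcal H$ such that $\phi_{m,n,r},\phi_{m,n,u}\in H^2[0,l]$ for all $m,n$, the family $(-\phi''_{m,n,r/u}+V\phi_{m,n,r/u})$ belongs to $\mathcal H$, and for all $m,n\in\mathbb{Z}$ \[ \phi_{m,n}:=\phi_{m,n,r}(0)=\tfrac1\beta\,\phi_{m,n,u}(0)=e^{-i\pi n\theta}\phi_{m-1,n,r}(l)=\tfrac1\beta\,e^{i\pi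 m\theta}\phi_{m,n-1,u}(l), \] \[ \phi'_{m,n,r}(0)+\beta\phi'_{m,n,u}(0)-e^{-i\pi n\theta}\phi'_{m-1,n,r}(l)-\beta e^{i\pi m\theta}\phi'_{m,n-1,u}(l)=\alpha\,\phi_{m,n}. \] Then $\operatorname{spec}D\subset\operatorname{spec}\Lambda$. Moreover, each $\mu\in\operatorname{spec}D$ is an infinitely degenerate eigenvalue of $\Lambda$, that is, the space $\{\phi\in\operatorname{dom}\Lambda:\Lambda\phi=\mu\phi\}$ is infinite-dimensional. -/

import Mathlib

open MeasureTheory Set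

namespace MagneticLattice

noncomputable section

/-! ### Unbounded operators: spectrum and eigenvalues -/

section Unbounded

variable {E : Type*} [NormedAddCommGroup E] [NormedSpace ℂ E]

/-- `z` lies in the resolvent set of the unbounded operator `T` when `T - z : dom T → E` has a
bounded inverse defined on all of `E`. -/
def resolventSet (T : E →ₗ.[ℂ] E) : Set ℂ :=
  {z | ∃ R : E →L[ℂ] E,
    (∀ y : E, ∃ h : R y ∈ T.domain, T ⟨R y, h⟩ - z • R y = y) ∧
    (∀ x : T.domain, R (T x - z • (x : E)) = x)}

/-- The spectrum of an unbounded operator. -/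
def spec (T : E →ₗ.[ℂ] E) : Set ℂ := (resolventSet T)ᶜ

/-- The space of all `x ∈ dom T` with `T x = z x`. -/
def eigenspace (T : E →ₗ.[ℂ] E) (z : ℂ) : Submodule ℂ E :=
  (LinearMap.ker (T.toFun - z • T.domain.subtype)).map T.domain.subtype

/-- `z` is an eigenvalue of `T`. -/
def IsEigenvalue (T : E →ₗ.[ℂ] E) (z : ℂ) : Prop := eigenspace T z ≠ ⊥

/-- `z` is an eigenvalue of `T` whose eigenspace has infinite dimension. -/
def IsInfinitelyDegenerateEigenvalue (T : E →ₗ.[ℂ] E) (z : ℂ) : Prop :=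
  IsEigenvalue T z ∧ ¬ FiniteDimensional ℂ (eigenspace T z)

end Unbounded

/-! ### A single edge -/

/-- Lebesgue measure on `[0, l]`. -/
abbrev edgeMeasure (l : ℝ) : Measure ℝ := volume.restrict (Icc 0 l)

/-- The Hilbert space `L²[0, l]`. -/
abbrev EdgeL2 (l : ℝ) : Type := Lp ℂ 2 (edgeMeasure l)

/-- `f` belongs to the Sobolev space `H²[0, l]`, with first derivative `f'` and second
derivative `f''`: `f` is differentiable on `[0, l]` with derivative `f'`, the function `f'` is
absolutely continuous, and its almost everywhere derivative `f''` is square integrable. -/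
structure IsH2 (l : ℝ) (f f' f'' : ℝ → ℂ) : Prop where
  hasDeriv : ∀ t ∈ Icc 0 l, HasDerivWithinAt f (f' t) (Icc 0 l) t
  absCont : AbsolutelyContinuousOnInterval f' 0 l
  hasDeriv_ae : ∀ᵐ t ∂(edgeMeasure l), HasDerivAt f' (f'' t) t
  memLp : MemLp f'' 2 (edgeMeasure l)

/-- The class `u ∈ L²[0, l]` lies in `H²[0, l]`, its `C¹` representative is `f`, with
derivative `f'`, and `v = - u'' + V u`. -/
def EdgeAction (l : ℝ) (V : ℝ → ℝ) (u v : EdgeL2 l) (f f' : ℝ → ℂ) : Prop :=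
  ∃ f'' : ℝ → ℂ, IsH2 l f f' f'' ∧ u =ᵐ[edgeMeasure l] f ∧
    v =ᵐ[edgeMeasure l] fun t => - f'' t + (V t : ℂ) * f t

theorem EdgeAction.zero (l : ℝ) (V : ℝ → ℝ) : EdgeAction l V 0 0 0 0 := by
  refine ⟨0, ⟨fun t _ => ?_, ?_, ?_, MemLp.zero⟩, Lp.coeFn_zero _ _ _, ?_⟩
  · exact hasDerivWithinAt_const t _ (0 : ℂ)
  · have h : LipschitzOnWith 0 (0 : ℝ → ℂ) (uIcc 0 l) :=
      (LipschitzWith.const (0 : ℂ)).lipschitzOnWith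
    exact h.absolutelyContinuousOnInterval
  · exact Filter.Eventually.of_forall fun t => hasDerivAt_const t (0 : ℂ)
  · filter_upwards [Lp.coeFn_zero ℂ 2 (edgeMeasure l)] with t ht
    rw [ht]
    simp

theorem EdgeAction.add {l : ℝ} {V : ℝ → ℝ} {u v u₁ v₁ : EdgeL2 l} {f f' g g' : ℝ → ℂ}
    (h : EdgeAction l V u v f f') (h₁ : EdgeAction l V u₁ v₁ g g') :
    EdgeAction l V (u + u₁) (v + v₁) (f + g) (f' + g') := by
  obtain ⟨f'', H, hu, hv⟩ := h
  obtain ⟨g'', H₁, hu₁, hv₁⟩ := h₁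
  refine ⟨f'' + g'', ⟨fun t ht => (H.hasDeriv t ht).add (H₁.hasDeriv t ht),
    H.absCont.add H₁.absCont, ?_, H.memLp.add H₁.memLp⟩, ?_, ?_⟩
  · filter_upwards [H.hasDeriv_ae, H₁.hasDeriv_ae] with t a b using a.add b
  · filter_upwards [Lp.coeFn_add u u₁, hu, hu₁] with t a b c
    rw [a, Pi.add_apply, b, c, Pi.add_apply]
  · filter_upwards [Lp.coeFn_add v v₁, hv, hv₁] with t a b c
    simp only [a, b, c, Pi.add_apply]
    ring

theorem EdgeAction.smul {l : ℝ} {V : ℝ → ℝ} {u v : EdgeL2 l} {f f' : ℝ → ℂ} (c : ℂ)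
    (h : EdgeAction l V u v f f') : EdgeAction l V (c • u) (c • v) (c • f) (c • f') := by
  obtain ⟨f'', H, hu, hv⟩ := h
  refine ⟨c • f'', ⟨fun t ht => (H.hasDeriv t ht).const_smul c,
    H.absCont.const_smul c, ?_, H.memLp.const_smul c⟩, ?_, ?_⟩
  · filter_upwards [H.hasDeriv_ae] with t a using a.const_smul c
  · filter_upwards [Lp.coeFn_smul c u, hu] with t a b
    simp [a, b]
  · filter_upwards [Lp.coeFn_smul c v, hv] with t a b
    simp only [a, b, Pi.smul_apply, smul_eq_mul]
    ring

theorem EdgeAction.eq_zero {l : ℝ} (hl : 0 < l) {V : ℝ → ℝ} {v : EdgeL2 l} {f f' : ℝ → ℂ}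
    (h : EdgeAction l V 0 v f f') : v = 0 := by
  obtain ⟨f'', H, hu, hv⟩ := h
  have hcont : ContinuousOn f (Icc 0 l) := fun t ht => (H.hasDeriv t ht).continuousWithinAt
  have hf0 : ∀ t ∈ Icc 0 l, f t = 0 := by
    have hae : f =ᵐ[edgeMeasure l] fun _ => (0 : ℂ) :=
      hu.symm.trans (Lp.coeFn_zero ℂ 2 (edgeMeasure l))
    have := Measure.eqOn_Icc_of_ae_eq volume hl.ne hae hcont continuousOn_const
    exact fun t ht => this ht
  have hf'0 : ∀ t ∈ Icc 0 l, f' t = 0 := fun t ht =>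
    (uniqueDiffOn_Icc hl t ht).eq_deriv _ (H.hasDeriv t ht)
      ((hasDerivWithinAt_const t _ (0 : ℂ)).congr hf0 (hf0 t ht))
  have hIoo : ∀ᵐ t ∂(edgeMeasure l), t ∈ Ioo 0 l := by
    have : edgeMeasure l = volume.restrict (Ioo 0 l) := (restrict_Ioo_eq_restrict_Icc).symm
    rw [this]
    exact ae_restrict_mem measurableSet_Ioo
  apply Lp.ext
  filter_upwards [Lp.coeFn_zero ℂ 2 (edgeMeasure l), hv, H.hasDeriv_ae, hIoo] with t h0 h1 h2 h3
  have h4 : HasDerivAt f' 0 t := (hasDerivAt_const t (0 : ℂ)).congr_of_eventuallyEq <| by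
    filter_upwards [Ioo_mem_nhds h3.1 h3.2] with s hs using hf'0 s (Ioo_subset_Icc_self hs)
  rw [h0, h1, h2.unique h4, hf0 t (Ioo_subset_Icc_self h3)]
  simp

/-- The graph of the Dirichlet operator `D`. -/
def dirichletGraph (l : ℝ) (V : ℝ → ℝ) : Submodule ℂ (EdgeL2 l × EdgeL2 l) where
  carrier := {p | ∃ f f' : ℝ → ℂ, EdgeAction l V p.1 p.2 f f' ∧ f 0 = 0 ∧ f l = 0}
  zero_mem' := ⟨0, 0, EdgeAction.zero l V, rfl, rfl⟩
  add_mem' := by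
    rintro p q ⟨f, f', h, h0, hl⟩ ⟨g, g', k, k0, kl⟩
    exact ⟨f + g, f' + g', h.add k, by simp [h0, k0], by simp [hl, kl]⟩
  smul_mem' := by
    rintro c p ⟨f, f', h, h0, hl⟩
    exact ⟨c • f, c • f', h.smul c, by simp [h0], by simp [hl]⟩

/-- The Dirichlet operator `D f = - f'' + V f` on `L²[0, l]`, with domain
`{f ∈ H²[0, l] | f 0 = f l = 0}`. -/
def dirichletOp (l : ℝ) (V : ℝ → ℝ) : EdgeL2 l →ₗ.[ℂ] EdgeL2 l :=
  (dirichletGraph l V).toLinearPMap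

theorem dirichletOp_graph {l : ℝ} (hl : 0 < l) (V : ℝ → ℝ) :
    (dirichletOp l V).graph = dirichletGraph l V := by
  refine Submodule.toLinearPMap_graph_eq _ ?_
  rintro ⟨u, v⟩ ⟨f, f', h, -, -⟩ hu
  obtain rfl : u = 0 := hu
  exact h.eq_zero hl

/-! ### The square lattice -/

/-- The two kinds of edges issuing from a node. -/
inductive Dir
  | right
  | up

/-- The edge `(m, n, right)` joins the node `(m, n)`, identified with `0 ∈ [0, l]`, to
`(m + 1, n)`, identified with `l`; the edge `(m, n, up)` joins `(m, n)` to `(m, n + 1)`. -/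
abbrev Edge : Type := ℤ × ℤ × Dir

/-- The phase space of the lattice: the Hilbert sum of `L²[0, l]` over all edges. -/
abbrev LatticeL2 (l : ℝ) : Type := lp (fun _ : Edge => EdgeL2 l) 2

/-- The phase `exp (i π x)`. -/
def phase (x : ℝ) : ℂ := Complex.exp (Complex.I * Real.pi * x)

/-- The boundary conditions at all nodes for a family `f` of functions on the edges with
derivatives `f'`. The value at the node `(m, n)` is `f (m, n, right) 0`. -/
structure NodeConditions (l θ α β : ℝ) (f f' : Edge → ℝ → ℂ) : Prop where
  value_up_start : ∀ m n : ℤ,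
    f (m, n, .right) 0 = 1 / (β : ℂ) * f (m, n, .up) 0
  value_right_end : ∀ m n : ℤ,
    f (m, n, .right) 0 = phase (-(n * θ)) * f (m - 1, n, .right) l
  value_up_end : ∀ m n : ℤ,
    f (m, n, .right) 0 = 1 / (β : ℂ) * phase (m * θ) * f (m, n - 1, .up) l
  flux : ∀ m n : ℤ,
    f' (m, n, .right) 0 + (β : ℂ) * f' (m, n, .up) 0
      - phase (-(n * θ)) * f' (m - 1, n, .right) l
      - (β : ℂ) * phase (m * θ) * f' (m, n - 1, .up) l
      = (α : ℂ) * f (m, n, .right) 0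

/-- The graph of the lattice Hamiltonian `Λ`. -/
def latticeGraph (l : ℝ) (V : ℝ → ℝ) (θ α β : ℝ) :
    Submodule ℂ (LatticeL2 l × LatticeL2 l) where
  carrier := {p | ∃ f f' : Edge → ℝ → ℂ,
    (∀ e, EdgeAction l V (p.1 e) (p.2 e) (f e) (f' e)) ∧ NodeConditions l θ α β f f'}
  zero_mem' := ⟨0, 0, fun _ => EdgeAction.zero l V, by constructor <;> simp⟩
  add_mem' := by
    rintro p q ⟨f, f', h, hb⟩ ⟨g, g', k, kb⟩
    refine ⟨f + g, f' + g', fun e => (h e).add (k e), ?_, ?_, ?_, ?_⟩ <;> intro m n <;>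
      simp only [Pi.add_apply]
    · linear_combination hb.value_up_start m n + kb.value_up_start m n
    · linear_combination hb.value_right_end m n + kb.value_right_end m n
    · linear_combination hb.value_up_end m n + kb.value_up_end m n
    · linear_combination hb.flux m n + kb.flux m n
  smul_mem' := by
    rintro c p ⟨f, f', h, hb⟩
    refine ⟨c • f, c • f', fun e => (h e).smul c, ?_, ?_, ?_, ?_⟩ <;> intro m n <;>
      simp only [Pi.smul_apply, smul_eq_mul]
    · linear_combination c * hb.value_up_start m n
    · linear_combination c * hb.value_right_end m n
    · linear_combination c * hb.value_up_end m n
    · linear_combination c * hb.flux m n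

/-- The lattice Hamiltonian `Λ`: it acts as `φ ↦ - φ'' + V φ` on every edge; its domain
consists of all `φ` in the phase space that are in `H²[0, l]` on every edge, satisfy the node
conditions, and for which `- φ'' + V φ` is again in the phase space. -/
def latticeOp (l : ℝ) (V : ℝ → ℝ) (θ α β : ℝ) : LatticeL2 l →ₗ.[ℂ] LatticeL2 l :=
  (latticeGraph l V θ α β).toLinearPMap

theorem latticeOp_graph {l : ℝ} (hl : 0 < l) (V : ℝ → ℝ) (θ α β : ℝ) :
    (latticeOp l V θ α β).graph = latticeGraph l V θ α β := by
  refine Submodule.toLinearPMap_graph_eq _ ?_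
  rintro ⟨u, v⟩ ⟨f, f', h, -⟩ hu
  obtain rfl : u = 0 := hu
  refine lp.ext (funext fun e => ?_)
  exact (h e).eq_zero hl

end

end MagneticLattice

/-!
Integration against the Green function of `- d²/dt²` is a compact operator on functions on `[0, l]`
which, composed with multiplication by `V ∈ L²`, stays compact on `L²[0, l]`. Hence `D - z` is
invertible unless the equation `- u'' = (z - V) u` with Dirichlet conditions has a nonzero
solution, and the spectrum of `D` consists of eigenvalues.

Copy a Dirichlet eigenfunction to finitely many edges `e` of the lattice, with coefficients `c e`.
All values at the nodes vanish, so the node conditions on `c` reduce to one linear equation per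
node. The `4 k` edges issuing from a `k × 2` block touch at most `3 (k + 1)` nodes, so the space of
solutions has dimension at least `k - 3`, for every `k`.
-/

namespace MagneticLattice

noncomputable section

open scoped BoundedContinuousFunction ENNReal
open Filter

section Unbounded

variable {E : Type*} [NormedAddCommGroup E] [NormedSpace ℂ E] {T : E →ₗ.[ℂ] E} {z : ℂ}

theorem mem_eigenspace_iff {x : E} : x ∈ eigenspace T z ↔ (x, z • x) ∈ T.graph := by
  simp only [eigenspace, Submodule.mem_map, LinearMap.mem_ker, LinearMap.sub_apply,
    LinearMap.smul_apply, Submodule.subtype_apply, LinearPMap.toFun_eq_coe, sub_eq_zero,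
    LinearPMap.mem_graph_iff]
  constructor
  · rintro ⟨y, hy, rfl⟩
    exact ⟨y, rfl, hy⟩
  · rintro ⟨y, rfl, hy⟩
    exact ⟨y, hy, rfl⟩

theorem isEigenvalue_iff_exists_mem_graph :
    IsEigenvalue T z ↔ ∃ x ≠ 0, (x, z • x) ∈ T.graph := by
  simp only [IsEigenvalue, Submodule.ne_bot_iff, mem_eigenspace_iff, and_comm]

theorem IsEigenvalue.mem_spec (h : IsEigenvalue T z) : z ∈ spec T := by
  rintro ⟨R, -, hR⟩
  obtain ⟨x, hx0, hx⟩ := isEigenvalue_iff_exists_mem_graph.1 h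
  obtain ⟨x, rfl, hTx⟩ := (LinearPMap.mem_graph_iff _).1 hx
  have hx' : R (T x - z • (x : E)) = x := hR x
  rw [hTx, sub_self, map_zero] at hx'
  exact hx0 hx'.symm

theorem isInfinitelyDegenerateEigenvalue_iff :
    IsInfinitelyDegenerateEigenvalue T z ↔ ¬ FiniteDimensional ℂ (eigenspace T z) := by
  refine and_iff_right_of_imp fun h hbot => h ?_
  rw [hbot]
  infer_instance

theorem mem_resolventSet_of_right_inverse (hT : ¬ IsEigenvalue T z) (R : E →L[ℂ] E)
    (hR : ∀ y, (R y, z • R y + y) ∈ T.graph) : z ∈ resolventSet T := by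
  refine ⟨R, fun y => ?_, fun x => ?_⟩
  · obtain ⟨x, hx, hTx⟩ := (LinearPMap.mem_graph_iff _).1 (hR y)
    dsimp only at hx hTx
    rw [← hx] at hTx ⊢
    exact ⟨x.2, sub_eq_iff_eq_add'.2 hTx⟩
  · by_contra hne
    refine hT (isEigenvalue_iff_exists_mem_graph.2 ⟨_, sub_ne_zero.2 hne, ?_⟩)
    convert T.graph.sub_mem (hR (T x - z • (x : E))) (T.mem_graph x) using 1
    simp only [Prod.mk_sub_mk, smul_sub]
    abel_nf

/-- By the Fredholm alternative for `K`, the inverse of `T - z` is `(1 - K)⁻¹ G` unless `1` is an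
eigenvalue of `K`. -/
theorem isEigenvalue_of_mem_spec_of_isCompactOperator [CompleteSpace E] {K : E →L[ℂ] E}
    (hK : IsCompactOperator K) (G : E →L[ℂ] E)
    (hKG : ∀ u y, u = K u + G y → (u, z • u + y) ∈ T.graph) (hz : z ∈ spec T) :
    IsEigenvalue T z := by
  by_contra hT
  rcases hK.hasEigenvalue_or_mem_resolventSet (one_ne_zero (α := ℂ)) with hK1 | hK1
  · obtain ⟨u, hu, hu0⟩ := hK1.exists_hasEigenvector
    have hKu : K u = u := by simpa using Module.End.mem_eigenspace_iff.1 hu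
    refine hT (isEigenvalue_iff_exists_mem_graph.2 ⟨u, hu0, ?_⟩)
    simpa using hKG u 0 (by simp [hKu])
  · have hunit : IsUnit (1 - K) := by simpa [spectrum.mem_resolventSet_iff] using hK1
    obtain ⟨B, hB⟩ := hunit.exists_right_inv
    refine hz (mem_resolventSet_of_right_inverse hT (B ∘L G) fun y => hKG _ y ?_)
    exact sub_eq_iff_eq_add'.1 (DFunLike.congr_fun hB (G y))

end Unbounded

section FlipApply

variable {X 𝕜 E F : Type*} [TopologicalSpace X] [CompactSpace X] [NontriviallyNormedField 𝕜]
  [NormedAddCommGroup E] [NormedSpace 𝕜 E] [NormedAddCommGroup F] [NormedSpace 𝕜 F]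

/-- The operator `h ↦ (x ↦ κ x h)` into the continuous functions on `X` given by a norm continuous
family of operators `κ`. For functionals `κ x` on a function space it is the integral operator
whose kernel has the sections `κ x`. -/
def flipApply (κ : C(X, E →L[𝕜] F)) : E →L[𝕜] (X →ᵇ F) :=
  LinearMap.mkContinuous
    { toFun h := BoundedContinuousFunction.mkOfCompact
        ⟨fun x => κ x h, κ.continuous.clm_apply continuous_const⟩
      map_add' h k := by ext x; exact map_add (κ x) h k
      map_smul' c h := by ext x; exact map_smul (κ x) c h }
    ‖κ‖ fun h => (BoundedContinuousFunction.norm_le (by positivity)).2 fun x =>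
      (κ x).le_of_opNorm_le (κ.norm_coe_le_norm x) h

theorem flipApply_apply (κ : C(X, E →L[𝕜] F)) (h : E) (x : X) : flipApply κ h x = κ x h := rfl

theorem isCompactOperator_flipApply [ProperSpace F] (κ : C(X, E →L[𝕜] F)) :
    IsCompactOperator (flipApply κ) := by
  refine (isCompactOperator_iff_isCompact_closure_image_closedBall
    (flipApply κ).toLinearMap one_pos).2 (BoundedContinuousFunction.arzela_ascoli
      (Metric.closedBall 0 ‖κ‖) (isCompact_closedBall _ _) _ ?_ fun x₀ => ?_)
  · rintro _ x ⟨h, hh, rfl⟩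
    rw [mem_closedBall_zero_iff] at hh ⊢
    exact ((κ x).unit_le_opNorm h hh).trans (κ.norm_coe_le_norm x)
  · refine Metric.equicontinuousAt_of_continuity_modulus (fun x => ‖κ x₀ - κ x‖) ?_ _
      (Eventually.of_forall ?_)
    · have hcont : Continuous fun x => ‖κ x₀ - κ x‖ := by fun_prop
      simpa using hcont.tendsto x₀
    · rintro x ⟨_, h, hh, rfl⟩
      rw [mem_closedBall_zero_iff] at hh
      rw [dist_eq_norm]
      exact (κ x₀ - κ x).unit_le_opNorm h hh

end FlipApply

section Green

variable {E : Type*} [NormedAddCommGroup E] [NormedSpace ℝ E] {l : ℝ}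

theorem absolutelyContinuousOnInterval_of_dist_le {X Y : Type*} [PseudoMetricSpace X]
    [PseudoMetricSpace Y] {f : ℝ → X} {g : ℝ → Y} {a b : ℝ}
    (hg : AbsolutelyContinuousOnInterval g a b)
    (h : ∀ x ∈ uIcc a b, ∀ y ∈ uIcc a b, dist (f x) (f y) ≤ dist (g x) (g y)) :
    AbsolutelyContinuousOnInterval f a b := by
  rw [absolutelyContinuousOnInterval_iff] at hg ⊢
  intro ε hε
  obtain ⟨δ, hδ, hgδ⟩ := hg ε hε
  refine ⟨δ, hδ, fun I hI hIδ => (Finset.sum_le_sum fun i hi => ?_).trans_lt (hgδ I hI hIδ)⟩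
  exact h _ (hI.1 i hi).1 _ (hI.1 i hi).2

theorem absolutelyContinuousOnInterval_integral {φ : ℝ → E} {a b : ℝ}
    (hφ : IntervalIntegrable φ volume a b) :
    AbsolutelyContinuousOnInterval (fun t => ∫ s in a..t, φ s) a b := by
  refine absolutelyContinuousOnInterval_of_dist_le
    (hφ.norm.absolutelyContinuousOnInterval_intervalIntegral left_mem_uIcc) fun x hx y hy => ?_
  have hφx : IntervalIntegrable φ volume a x := hφ.mono_set (uIcc_subset_uIcc_left hx)
  have hφy : IntervalIntegrable φ volume a y := hφ.mono_set (uIcc_subset_uIcc_left hy)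
  rw [dist_eq_norm, Real.dist_eq, intervalIntegral.integral_interval_sub_left hφx hφy,
    intervalIntegral.integral_interval_sub_left hφx.norm hφy.norm]
  exact intervalIntegral.norm_integral_le_abs_integral_norm

/-- The Green function `min t s (1 - max t s / l)` of `- d²/dt²` on `[0, l]` with Dirichlet boundary
conditions, written without the maximum. -/
def greenKernel (l t s : ℝ) : ℝ := min t s - t * (s / l)

theorem greenKernel_zero_left {s : ℝ} (hs : 0 ≤ s) : greenKernel l 0 s = 0 := by
  simp [greenKernel, hs]

theorem greenKernel_self_left (hl : l ≠ 0) {s : ℝ} (hs : s ≤ l) : greenKernel l l s = 0 := by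
  rw [greenKernel, min_eq_right hs, mul_div_cancel₀ s hl, sub_self]

@[fun_prop]
theorem continuous_greenKernel (l t : ℝ) : Continuous (greenKernel l t) := by
  unfold greenKernel
  fun_prop

theorem lipschitzWith_greenKernel {s : ℝ} (hs : s ∈ Icc 0 l) :
    LipschitzWith 2 fun t => greenKernel l t s := by
  refine LipschitzWith.of_dist_le_mul fun t t' => ?_
  have hmin : |min t s - min t' s| ≤ |t - t'| := by
    simpa using abs_min_sub_min_le_max t s t' s
  have hlin : |(t - t') * (s / l)| ≤ |t - t'| := by
    have hl : 0 ≤ l := hs.1.trans hs.2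
    rw [abs_mul, abs_of_nonneg (div_nonneg hs.1 hl)]
    exact mul_le_of_le_one_right (abs_nonneg _) (div_le_one_of_le₀ hs.2 hl)
  calc |greenKernel l t s - greenKernel l t' s|
      = |(min t s - min t' s) - (t - t') * (s / l)| := by
        simp only [greenKernel]; ring_nf
    _ ≤ |min t s - min t' s| + |(t - t') * (s / l)| := abs_sub _ _
    _ ≤ 2 * |t - t'| := by linarith

theorem abs_greenKernel_le {s : ℝ} (hs : s ∈ Icc 0 l) (t : ℝ) :
    |greenKernel l t s| ≤ 2 * |t| := by
  simpa [Real.dist_eq, greenKernel_zero_left hs.1] using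
    (lipschitzWith_greenKernel hs).dist_le_mul t 0

theorem hasDerivAt_greenKernel_of_lt {s t : ℝ} (h : t < s) :
    HasDerivAt (fun t => greenKernel l t s) (1 - s / l) t := by
  have hlin : HasDerivAt (fun t : ℝ => t - t * (s / l)) (1 - s / l) t := by
    simpa using (hasDerivAt_id' t).fun_sub ((hasDerivAt_id' t).mul_const (s / l))
  refine hlin.congr_of_eventuallyEq ?_
  filter_upwards [Iio_mem_nhds h] with τ hτ
  rw [greenKernel, min_eq_left (le_of_lt hτ)]

theorem hasDerivAt_greenKernel_of_gt {s t : ℝ} (h : s < t) :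
    HasDerivAt (fun t => greenKernel l t s) (-(s / l)) t := by
  have hlin : HasDerivAt (fun t : ℝ => s - t * (s / l)) (-(s / l)) t := by
    simpa using ((hasDerivAt_id' t).mul_const (s / l)).const_sub s
  refine hlin.congr_of_eventuallyEq ?_
  filter_upwards [Ioi_mem_nhds h] with τ hτ
  rw [greenKernel, min_eq_right (le_of_lt hτ)]

/-- The solution `f` of `- f'' = φ` on `[0, l]` with `f 0 = f l = 0`. -/
def green (l : ℝ) (φ : ℝ → E) (t : ℝ) : E :=
  ∫ s, greenKernel l t s • φ s ∂edgeMeasure l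

/-- The derivative of `green l φ` on `[0, l]`. -/
def greenDeriv (l : ℝ) (φ : ℝ → E) (t : ℝ) : E :=
  (∫ s, (1 - s / l) • φ s ∂edgeMeasure l) - ∫ s in 0..t, φ s

theorem green_zero (l : ℝ) (φ : ℝ → E) : green l φ 0 = 0 := by
  refine setIntegral_eq_zero_of_forall_eq_zero fun s hs => ?_
  rw [greenKernel_zero_left hs.1, zero_smul]

theorem green_self (hl : l ≠ 0) (φ : ℝ → E) : green l φ l = 0 := by
  refine setIntegral_eq_zero_of_forall_eq_zero fun s hs => ?_
  rw [greenKernel_self_left hl hs.2, zero_smul]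

theorem integrable_greenKernel_smul {φ : ℝ → E} (hφ : Integrable φ (edgeMeasure l)) (t : ℝ) :
    Integrable (fun s => greenKernel l t s • φ s) (edgeMeasure l) :=
  IntegrableOn.continuousOn_smul hφ (by fun_prop) isCompact_Icc

theorem setIntegral_Iic_edgeMeasure (φ : ℝ → E) {t : ℝ} (ht : t ∈ Icc 0 l) :
    ∫ s in Iic t, φ s ∂edgeMeasure l = ∫ s in 0..t, φ s := by
  have hset : Iic t ∩ Icc 0 l = Icc 0 t := by
    ext s
    exact ⟨fun hs => ⟨hs.2.1, hs.1⟩, fun hs => ⟨hs.2, hs.1, hs.2.trans ht.2⟩⟩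
  rw [Measure.restrict_restrict measurableSet_Iic, hset,
    integral_Icc_eq_integral_Ioc, intervalIntegral.integral_of_le ht.1]

theorem hasDerivAt_green {φ : ℝ → E} (hφ : Integrable φ (edgeMeasure l)) {t : ℝ}
    (ht : t ∈ Icc 0 l) : HasDerivAt (green l φ) (greenDeriv l φ t) t := by
  have hψ : Integrable (fun s => (1 - s / l) • φ s) (edgeMeasure l) :=
    IntegrableOn.continuousOn_smul hφ (by fun_prop) isCompact_Icc
  have hind : Integrable ((Iic t).indicator φ) (edgeMeasure l) := hφ.indicator measurableSet_Iic
  have hderiv : HasDerivAt (green l φ)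
      (∫ s, ((1 - s / l) • φ s - (Iic t).indicator φ s) ∂edgeMeasure l) t := by
    refine (hasDerivAt_integral_of_dominated_loc_of_lip (bound := fun s => 2 * ‖φ s‖) univ_mem
      (Eventually.of_forall fun τ => (integrable_greenKernel_smul hφ τ).1)
      (integrable_greenKernel_smul hφ t) (hψ.sub hind).1 ?_ (hφ.norm.const_mul 2) ?_).2
    · filter_upwards [ae_restrict_mem measurableSet_Icc] with s hs
      refine LipschitzOnWith.of_dist_le_mul fun τ _ τ' _ => ?_
      rw [dist_eq_norm, ← sub_smul, norm_smul, Real.norm_eq_abs, ← Real.dist_eq, Real.coe_nnabs,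
        abs_of_nonneg (by positivity), mul_right_comm]
      gcongr
      exact (lipschitzWith_greenKernel hs).dist_le_mul τ τ'
    · filter_upwards [compl_mem_ae_iff.2 (measure_singleton t)] with s hst
      rcases Ne.lt_or_gt hst with h | h
      · simpa [indicator_of_mem (mem_Iic.2 h.le), sub_smul] using
          (hasDerivAt_greenKernel_of_gt (l := l) h).smul_const (φ s)
      · simpa [indicator_of_notMem (notMem_Iic.2 h)] using
          (hasDerivAt_greenKernel_of_lt (l := l) h).smul_const (φ s)
  rwa [integral_sub hψ hind, integral_indicator measurableSet_Iic,
    setIntegral_Iic_edgeMeasure φ ht] at hderiv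

end Green

section DirichletSpectrum

variable {l : ℝ}

theorem isH2_green (hl : 0 ≤ l) {φ : ℝ → ℂ} (hφ : MemLp φ 2 (edgeMeasure l)) :
    IsH2 l (green l φ) (greenDeriv l φ) (-φ) := by
  have hint : Integrable φ (edgeMeasure l) := hφ.integrable one_le_two
  have hinterval : IntervalIntegrable φ volume 0 l :=
    (intervalIntegrable_iff_integrableOn_Icc_of_le hl).2 hint
  refine ⟨fun t ht => (hasDerivAt_green hint ht).hasDerivWithinAt, ?_, ?_, hφ.neg⟩
  · exact (LipschitzWith.const _).lipschitzOnWith.absolutelyContinuousOnInterval.sub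
      (absolutelyContinuousOnInterval_integral hinterval)
  · filter_upwards [ae_restrict_of_ae hinterval.ae_hasDerivAt_integral,
      ae_restrict_mem measurableSet_Icc] with t ht hmem
    exact (ht (Icc_subset_uIcc hmem) 0 left_mem_uIcc).const_sub _

theorem mem_dirichletGraph_of_ae_eq_green (hl : 0 < l) {V : ℝ → ℝ} {φ : ℝ → ℂ}
    (hφ : MemLp φ 2 (edgeMeasure l)) {u v : EdgeL2 l} (hu : u =ᵐ[edgeMeasure l] green l φ)
    (hv : v =ᵐ[edgeMeasure l] fun t => φ t + V t * u t) : (u, v) ∈ dirichletGraph l V := by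
  refine ⟨green l φ, greenDeriv l φ, ⟨-φ, isH2_green hl.le hφ, hu, ?_⟩, green_zero l φ,
    green_self hl.ne' φ⟩
  filter_upwards [hu, hv] with t hut hvt
  rw [hvt, hut, Pi.neg_apply, neg_neg]

theorem memLp_greenKernel (l t : ℝ) :
    MemLp (fun s => (greenKernel l t s : ℂ)) ∞ (edgeMeasure l) := by
  refine memLp_top_of_bound (Continuous.aestronglyMeasurable (by fun_prop)) (2 * |t|) ?_
  filter_upwards [ae_restrict_mem measurableSet_Icc] with s hs
  simpa using abs_greenKernel_le hs t

/-- The section `greenKernel l t` of the Green function, as an element of `L^∞[0, l]`. -/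
def greenKernelLp (l t : ℝ) : Lp ℂ ∞ (edgeMeasure l) := (memLp_greenKernel l t).toLp

theorem lipschitzWith_greenKernelLp (l : ℝ) : LipschitzWith 2 (greenKernelLp l) := by
  refine LipschitzWith.of_dist_le_mul fun t t' => ?_
  rw [dist_eq_norm]
  refine (Lp.norm_le_of_ae_bound (C := 2 * dist t t') (by positivity) ?_).trans_eq (by simp)
  filter_upwards [Lp.coeFn_sub (greenKernelLp l t) (greenKernelLp l t'),
    (memLp_greenKernel l t).coeFn_toLp, (memLp_greenKernel l t').coeFn_toLp,
    ae_restrict_mem measurableSet_Icc] with s hsub ht ht' hs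
  rw [hsub, Pi.sub_apply, greenKernelLp, greenKernelLp, ht, ht', ← Complex.ofReal_sub,
    Complex.norm_real]
  exact (lipschitzWith_greenKernel hs).dist_le_mul t t'

/-- The functionals `h ↦ green l h t` on `L¹[0, l]`, for `t ∈ [0, l]`. -/
def greenFunctional (l : ℝ) : C(Icc 0 l, Lp ℂ 1 (edgeMeasure l) →L[ℂ] ℂ) where
  toFun t := (ContinuousLinearMap.mul ℂ ℂ).lpPairing (edgeMeasure l) ∞ 1 (greenKernelLp l t)
  continuous_toFun := by
    have := (lipschitzWith_greenKernelLp l).continuous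
    fun_prop

theorem greenFunctional_apply (t : Icc 0 l) (h : Lp ℂ 1 (edgeMeasure l)) :
    greenFunctional l t h = green l h t := by
  refine (ContinuousLinearMap.lpPairing_eq_integral _ _ _).trans (integral_congr_ae ?_)
  filter_upwards [(memLp_greenKernel l t).coeFn_toLp] with s hs
  rw [greenKernelLp, hs, ContinuousLinearMap.mul_apply', Complex.real_smul]

/-- The operator `h ↦ green l h` from `L¹[0, l]` to `L²[0, l]`. -/
def greenOp (hl : 0 ≤ l) : Lp ℂ 1 (edgeMeasure l) →L[ℂ] EdgeL2 l :=
  BoundedContinuousFunction.toLp 2 (edgeMeasure l) ℂ ∘L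
    BoundedContinuousFunction.compContinuousCLM (β := ℂ) (𝕜 := ℂ)
      ⟨projIcc 0 l hl, continuous_projIcc⟩ ∘L
    flipApply (greenFunctional l)

theorem isCompactOperator_greenOp (hl : 0 ≤ l) : IsCompactOperator (greenOp hl) := by
  simpa only [greenOp, ContinuousLinearMap.coe_comp] using!
    ((isCompactOperator_flipApply (greenFunctional l)).clm_comp _).clm_comp _

theorem memLp_top_greenOp (hl : 0 ≤ l) (h : Lp ℂ 1 (edgeMeasure l)) :
    MemLp (greenOp hl h) ∞ (edgeMeasure l) :=
  (BoundedContinuousFunction.memLp_top _).ae_eq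
    (BoundedContinuousFunction.coeFn_toLp 2 (edgeMeasure l) ℂ _).symm

theorem coeFn_greenOp (hl : 0 ≤ l) (h : Lp ℂ 1 (edgeMeasure l)) :
    greenOp hl h =ᵐ[edgeMeasure l] green l h := by
  refine (BoundedContinuousFunction.coeFn_toLp 2 (edgeMeasure l) ℂ _).trans ?_
  filter_upwards [ae_restrict_mem measurableSet_Icc] with t ht
  refine (flipApply_apply (greenFunctional l) h (projIcc 0 l hl t)).trans ?_
  rw [greenFunctional_apply, projIcc_of_mem hl ht]

/-- Multiplication by `p ∈ L²[0, l]`, as an operator from `L²[0, l]` to `L¹[0, l]`. -/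
def mulL2 (p : EdgeL2 l) : EdgeL2 l →L[ℂ] Lp ℂ 1 (edgeMeasure l) :=
  (ContinuousLinearMap.mul ℂ ℂ).holderL (edgeMeasure l) 2 2 1 p

theorem coeFn_mulL2 {p : ℝ → ℂ} (hp : MemLp p 2 (edgeMeasure l)) (u : EdgeL2 l) :
    mulL2 hp.toLp u =ᵐ[edgeMeasure l] fun t => p t * u t := by
  filter_upwards [(ContinuousLinearMap.mul ℂ ℂ).coeFn_holder (r := 1) hp.toLp u, hp.coeFn_toLp]
    with t hmul hpt
  rw [← hpt]
  exact hmul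

theorem isEigenvalue_of_mem_spec_dirichletOp (hl : 0 < l) {V : ℝ → ℝ}
    (hV : MemLp V 2 (edgeMeasure l)) {z : ℂ} (hz : z ∈ spec (dirichletOp l V)) :
    IsEigenvalue (dirichletOp l V) z := by
  have hVc : MemLp (fun t => (V t : ℂ)) 2 (edgeMeasure l) := hV.ofReal
  have hp : MemLp (fun t => z - V t) 2 (edgeMeasure l) := (memLp_const z).sub hVc
  have h1 : MemLp (fun _ => (1 : ℂ)) 2 (edgeMeasure l) := memLp_const 1
  let K : EdgeL2 l →L[ℂ] EdgeL2 l := greenOp hl.le ∘L mulL2 hp.toLp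
  let G : EdgeL2 l →L[ℂ] EdgeL2 l := greenOp hl.le ∘L mulL2 h1.toLp
  have hK : IsCompactOperator K := (isCompactOperator_greenOp hl.le).comp_clm _
  refine isEigenvalue_of_mem_spec_of_isCompactOperator hK G (fun u y huy => ?_) hz
  set h := mulL2 hp.toLp u + mulL2 h1.toLp y
  have hu : u = greenOp hl.le h := huy.trans (map_add (greenOp hl.le) _ _).symm
  have hh : h =ᵐ[edgeMeasure l] fun t => (z * u t + y t) - V t * u t := by
    filter_upwards [Lp.coeFn_add (mulL2 hp.toLp u) (mulL2 h1.toLp y), coeFn_mulL2 hp u,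
      coeFn_mulL2 h1 y] with t hadd hpu h1y
    rw [hadd, Pi.add_apply, hpu, h1y]
    ring
  have hVu : MemLp (fun t => V t * u t) 2 (edgeMeasure l) := by
    have hu_top : MemLp u ∞ (edgeMeasure l) := hu ▸ memLp_top_greenOp hl.le h
    exact hu_top.mul hVc
  have hL2 : MemLp h 2 (edgeMeasure l) :=
    ((((Lp.memLp u).const_mul z).add (Lp.memLp y)).sub hVu).ae_eq hh.symm
  rw [dirichletOp_graph hl]
  refine mem_dirichletGraph_of_ae_eq_green hl hL2 (hu ▸ coeFn_greenOp hl.le h) ?_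
  filter_upwards [hh, Lp.coeFn_add (z • u) y, Lp.coeFn_smul z u] with t hht hadd hsmul
  rw [hadd, Pi.add_apply, hsmul, hht, Pi.smul_apply, smul_eq_mul, sub_add_cancel]

end DirichletSpectrum

section Lattice

theorem card_le_card_add_finrank_ker {K ι κ : Type*} [DivisionRing K]
    (L : (ι →₀ K) →ₗ[K] (κ → K)) [FiniteDimensional K (LinearMap.ker L)] {s : Finset ι}
    {t : Finset κ} (h : ∀ c ∈ Finsupp.supported K K (s : Set ι), ∀ j ∉ t, L c j = 0) :
    s.card ≤ t.card + Module.finrank K (LinearMap.ker L) := by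
  let P : Submodule K (ι →₀ K) := Finsupp.supported K K s
  let A : P →ₗ[K] (t → K) := LinearMap.funLeft K K Subtype.val ∘ₗ L ∘ₗ P.subtype
  let eP : P ≃ₗ[K] (s →₀ K) := Finsupp.supportedEquivFinsupp _
  have : FiniteDimensional K P := eP.symm.finiteDimensional
  have hP : Module.finrank K P = s.card := by
    rw [eP.finrank_eq, Module.finrank_finsupp_self, Fintype.card_coe]
  have hrange : Module.finrank K (LinearMap.range A) ≤ t.card := by
    simpa using Submodule.finrank_le (LinearMap.range A)
  have hker : (LinearMap.ker A).map P.subtype ≤ LinearMap.ker L := by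
    rintro _ ⟨c, hc, rfl⟩
    refine LinearMap.mem_ker.2 (funext fun j => ?_)
    by_cases hj : j ∈ t
    · exact congrFun (LinearMap.mem_ker.1 hc) ⟨j, hj⟩
    · exact h c c.2 j hj
  have hker' : Module.finrank K (LinearMap.ker A) ≤ Module.finrank K (LinearMap.ker L) := by
    rw [← Submodule.finrank_map_subtype_eq]
    exact Submodule.finrank_mono hker
  have hrankNullity := LinearMap.finrank_range_add_finrank_ker (V := P) (V₂ := t → K) A
  omega

variable {l : ℝ}

/-- The lattice function equal to `c e • u` on the edge `e`. -/
def latticeState (u : EdgeL2 l) : (Edge →₀ ℂ) →ₗ[ℂ] LatticeL2 l where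
  toFun c := ⟨fun e => c e • u, by
    refine (memℓp_zero (c.support.finite_toSet.subset fun e he => ?_)).of_exponent_ge zero_le
    exact Finsupp.mem_support_iff.2 fun h0 => he (by simp [h0])⟩
  map_add' c d := lp.ext (funext fun e => add_smul (c e) (d e) u)
  map_smul' a c := lp.ext (funext fun e => mul_smul a (c e) u)

theorem latticeState_injective {u : EdgeL2 l} (hu : u ≠ 0) :
    Function.Injective (latticeState u) := fun _ _ h =>
  Finsupp.ext fun e => smul_left_injective ℂ hu (congrArg (fun φ : LatticeL2 l => φ e) h)

theorem latticeState_smul (z : ℂ) (u : EdgeL2 l) (c : Edge →₀ ℂ) :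
    latticeState (z • u) c = z • latticeState u c :=
  lp.ext (funext fun e => smul_comm (c e) z u)

/-- The left hand sides of the flux conditions at all nodes for the lattice function equal to
`c e • f` on the edge `e`, where `f` has the derivatives `a` at `0` and `b` at `l`. -/
def nodeFlux (θ β : ℝ) (a b : ℂ) : (Edge →₀ ℂ) →ₗ[ℂ] (ℤ × ℤ → ℂ) where
  toFun c x := c (x.1, x.2, .right) * a + (β : ℂ) * (c (x.1, x.2, .up) * a)
    - phase (-(x.2 * θ)) * (c (x.1 - 1, x.2, .right) * b)
    - (β : ℂ) * phase (x.1 * θ) * (c (x.1, x.2 - 1, .up) * b)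
  map_add' c d := by
    funext x
    simp only [Finsupp.add_apply, Pi.add_apply]
    ring
  map_smul' r c := by
    funext x
    simp only [Finsupp.smul_apply, Pi.smul_apply, smul_eq_mul, RingHom.id_apply]
    ring

theorem nodeFlux_apply (θ β : ℝ) (a b : ℂ) (c : Edge →₀ ℂ) (m n : ℤ) :
    nodeFlux θ β a b c (m, n) = c (m, n, .right) * a + (β : ℂ) * (c (m, n, .up) * a)
      - phase (-(n * θ)) * (c (m - 1, n, .right) * b)
      - (β : ℂ) * phase (m * θ) * (c (m, n - 1, .up) * b) := rfl

theorem mem_latticeGraph_latticeState {V : ℝ → ℝ} {θ α β : ℝ} {u v : EdgeL2 l} {f f' : ℝ → ℂ}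
    (h : EdgeAction l V u v f f') (h0 : f 0 = 0) (hl : f l = 0) {c : Edge →₀ ℂ}
    (hc : nodeFlux θ β (f' 0) (f' l) c = 0) :
    (latticeState u c, latticeState v c) ∈ latticeGraph l V θ α β := by
  refine ⟨fun e => c e • f, fun e => c e • f', fun e => h.smul (c e), ?_, ?_, ?_, ?_⟩ <;>
    intro m n
  · simp [h0]
  · simp [h0, hl]
  · simp [h0, hl]
  · simpa [h0] using! congrFun hc (m, n)

instance : Fintype Dir where
  elems := .cons .right {.up} (by simp)
  complete d := by cases d <;> simp

/-- The edges issuing from the nodes of a `k × 2` block. -/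
def blockEdges (k : ℕ) : Finset Edge := Finset.Ico 0 (k : ℤ) ×ˢ Finset.Ico 0 2 ×ˢ Finset.univ

/-- A set of nodes containing all endpoints of the edges in `blockEdges k`. -/
def blockNodes (k : ℕ) : Finset (ℤ × ℤ) := Finset.Ico 0 (k + 1 : ℤ) ×ˢ Finset.Ico 0 3

theorem card_blockEdges (k : ℕ) : (blockEdges k).card = k * 4 := by
  have hDir : Fintype.card Dir = 2 := rfl
  simp [blockEdges, hDir]

theorem card_blockNodes (k : ℕ) : (blockNodes k).card = (k + 1) * 3 := by
  simp [blockNodes]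

theorem nodeFlux_eq_zero_of_notMem (θ β : ℝ) (a b : ℂ) {k : ℕ} {c : Edge →₀ ℂ}
    (hc : c ∈ Finsupp.supported ℂ ℂ (blockEdges k : Set Edge)) {x : ℤ × ℤ}
    (hx : x ∉ blockNodes k) : nodeFlux θ β a b c x = 0 := by
  obtain ⟨m, n⟩ := x
  have hc' : ∀ i j d, (i, j, d) ∉ blockEdges k → c (i, j, d) = 0 := fun _ _ _ =>
    (Finsupp.mem_supported' ℂ c).1 hc _
  simp only [blockEdges, blockNodes, Finset.mem_product, Finset.mem_Ico, Finset.mem_univ,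
    and_true] at hx hc'
  rw [nodeFlux_apply, hc' m n .right (by omega), hc' m n .up (by omega),
    hc' (m - 1) n .right (by omega), hc' m (n - 1) .up (by omega)]
  simp

theorem not_finiteDimensional_ker_nodeFlux (θ β : ℝ) (a b : ℂ) :
    ¬ FiniteDimensional ℂ (LinearMap.ker (nodeFlux θ β a b)) := by
  intro hfin
  have hcard := card_le_card_add_finrank_ker (nodeFlux θ β a b)
    (s := blockEdges (Module.finrank ℂ (LinearMap.ker (nodeFlux θ β a b)) + 4))
    fun c hc x hx => nodeFlux_eq_zero_of_notMem θ β a b hc hx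
  rw [card_blockEdges, card_blockNodes] at hcard
  omega

theorem isInfinitelyDegenerateEigenvalue_latticeOp (hl : 0 < l) {V : ℝ → ℝ} {z : ℂ}
    (hz : IsEigenvalue (dirichletOp l V) z) (θ α β : ℝ) :
    IsInfinitelyDegenerateEigenvalue (latticeOp l V θ α β) z := by
  rw [isInfinitelyDegenerateEigenvalue_iff]
  intro hfin
  rw [isEigenvalue_iff_exists_mem_graph, dirichletOp_graph hl] at hz
  obtain ⟨u, hu, f, f', h, hf0, hfl⟩ := hz
  let N := LinearMap.ker (nodeFlux θ β (f' 0) (f' l))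
  have hmem : ∀ c ∈ N, latticeState u c ∈ eigenspace (latticeOp l V θ α β) z := fun c hc => by
    rw [mem_eigenspace_iff, latticeOp_graph hl, ← latticeState_smul]
    exact mem_latticeGraph_latticeState h hf0 hfl hc
  have hinj : Function.Injective ((latticeState u).restrict hmem) := fun c d hcd =>
    Subtype.ext (latticeState_injective hu (congrArg Subtype.val hcd))
  exact not_finiteDimensional_ker_nodeFlux θ β (f' 0) (f' l) (Module.Finite.of_injective _ hinj)

end Lattice

end

end MagneticLattice

theorem mainTheorem4 (l : ℝ) (hl : 0 < l) (V : ℝ → ℝ)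
    (hV : MeasureTheory.MemLp V 2 (MagneticLattice.edgeMeasure l))
    (θ α β : ℝ) (hβ : β ≠ 0) :
    MagneticLattice.spec (MagneticLattice.dirichletOp l V) ⊆
        MagneticLattice.spec (MagneticLattice.latticeOp l V θ α β) ∧
      ∀ μ ∈ MagneticLattice.spec (MagneticLattice.dirichletOp l V),
        MagneticLattice.IsInfinitelyDegenerateEigenvalue
          (MagneticLattice.latticeOp l V θ α β) μ := by
  have infDeg : ∀ μ ∈ MagneticLattice.spec (MagneticLattice.dirichletOp l V),
      MagneticLattice.IsInfinitelyDegenerateEigenvalue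
        (MagneticLattice.latticeOp l V θ α β) μ := fun _ hμ =>
    MagneticLattice.isInfinitelyDegenerateEigenvalue_latticeOp hl
      (MagneticLattice.isEigenvalue_of_mem_spec_dirichletOp hl hV hμ) θ α β
  exact ⟨fun μ hμ => (infDeg μ hμ).1.mem_spec, infDeg⟩
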